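/- Let $k$ be a number field with ring of integers $\mathcal{O}_k$. For a place $v$ of $k$ let $k_v$ be the completion, and for finite $v$ let $\mathcal{O}_v\subset k_v$ be its valuation ring. Let $\mathbb{I}_k$ be the idele group of $k$, that is, the restricted product of the groups $k_v^*$ over all places $v$ with respect to the compact open subgroups $\mathcal{O}_v^*\subset k_v^*$ ($v$ finite), with the restricted product topology. Let $$\varphi:\mathbb{I}_k\to\mathbb{R}^{>0},\qquad \varphi(x)=\prod_v |x_v|_v,$$ where $|\cdot|_v$ is the usual absolute value if $v$ is real, the square of the usual absolute value if $v$ is complex, and the absolute value with $|\pi|_v=|\mathcal{O}_k/\mathfrak{p}|^{-1}$ for a uniformizer $\pi$ if $v$ is the finite place of the prime $\mathfrak{p}$. Let $\mathbb{I}_k^0=\ker\varphi$ with the subspace topology; it contains the diagonally embedded group $k^*$ by the product formula. Then the norm-one idele class group $$C_k^0=\mathbb{I}_k^0/k^*,$$ with the quotient topology, is compact. -/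

import Mathlib

open scoped NumberField RestrictedProduct
open IsDedekindDomain NumberField

noncomputable section

namespace IdeleClass

variable (K : Type*) [Field K] [NumberField K]

/-- The ideles of a number field `K`: the restricted product, over all places `v` of `K`, of the
groups `K_vˣ` with respect to the compact open subgroups `O_vˣ` (`v` finite). As there are only
finitely many infinite places, where no subgroup is prescribed, this is the full product of the
`K_vˣ` over the infinite places times the restricted product over the finite ones. -/
abbrev Ideles : Type _ :=
  ((v : InfinitePlace K) → (v.Completion)ˣ) ×
    Πʳ v : HeightOneSpectrum (𝓞 K),
      [(v.adicCompletion K)ˣ, (v.adicCompletionIntegers K).units]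

variable {K}

theorem norm_eq_one_iff_mem_units (v : HeightOneSpectrum (𝓞 K)) (a : (v.adicCompletion K)ˣ) :
    ‖(a : v.adicCompletion K)‖ = 1 ↔ a ∈ (v.adicCompletionIntegers K).units := by
  rw [HeightOneSpectrum.adicCompletionIntegers.mem_units_iff_valued_eq_one, FinitePlace.norm_def]
  rw [NNReal.coe_eq_one]
  exact WithZeroMulInt.toNNReal_eq_one_iff _ (HeightOneSpectrum.absNorm_ne_zero v)
    (HeightOneSpectrum.one_lt_absNorm_nnreal v).ne'

theorem hasFiniteMulSupport_norm (x : Ideles K) :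
    (fun v : HeightOneSpectrum (𝓞 K) ↦ ‖(x.2 v : v.adicCompletion K)‖).HasFiniteMulSupport := by
  have h := x.2.eventually
  rw [Filter.eventually_cofinite] at h
  refine h.subset fun v hv hmem ↦ hv ?_
  exact (norm_eq_one_iff_mem_units v _).2 hmem

variable (K) in
/-- The idele norm `x ↦ ∏_v |x_v|_v`, with the normalized absolute values: at a real place the
usual absolute value, at a complex place its square (`v.mult` is `1` or `2`), and at the finite
place of a prime `𝔭` the one with `|ϖ|_𝔭 = 1 / N𝔭` for a uniformizer `ϖ`. All but finitely
many factors are `1`. -/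
def ideleNorm : Ideles K →* ℝ where
  toFun x := (∏ v : InfinitePlace K, ‖(x.1 v : v.Completion)‖ ^ v.mult) *
    ∏ᶠ v : HeightOneSpectrum (𝓞 K), ‖(x.2 v : v.adicCompletion K)‖
  map_one' := by simp
  map_mul' x y := by
    have h : ∏ᶠ v : HeightOneSpectrum (𝓞 K), ‖((x * y).2 v : v.adicCompletion K)‖ =
        (∏ᶠ v : HeightOneSpectrum (𝓞 K), ‖(x.2 v : v.adicCompletion K)‖) *
          ∏ᶠ v : HeightOneSpectrum (𝓞 K), ‖(y.2 v : v.adicCompletion K)‖ := by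
      rw [← finprod_mul_distrib (hasFiniteMulSupport_norm x) (hasFiniteMulSupport_norm y)]
      exact finprod_congr fun v ↦ by simp
    rw [h]
    simp only [Prod.fst_mul, Pi.mul_apply, Units.val_mul, norm_mul, mul_pow,
      Finset.prod_mul_distrib]
    ring

variable (K) in
/-- The group `𝕀_K^0` of ideles of norm one, with the subspace topology. -/
abbrev NormOneIdeles : Subgroup (Ideles K) := (ideleNorm K).ker

theorem eventually_mem_units (a : Kˣ) :
    ∀ᶠ v : HeightOneSpectrum (𝓞 K) in Filter.cofinite,
      Units.map (algebraMap K (v.adicCompletion K)).toMonoidHom a ∈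
        (v.adicCompletionIntegers K).units := by
  have h := (FinitePlace.hasFiniteMulSupport a.ne_zero).preimage
    (FinitePlace.equivHeightOneSpectrum (K := K)).symm.injective.injOn
  rw [Filter.eventually_cofinite]
  refine h.subset fun v hv hmem ↦ hv ?_
  exact (norm_eq_one_iff_mem_units v _).1 hmem

variable (K) in
/-- The diagonal embedding `Kˣ → 𝕀_K`, `a ↦ (a)_v`. -/
def diagonal : Kˣ →* Ideles K where
  toFun a := ⟨fun v ↦ Units.map (algebraMap K v.Completion).toMonoidHom a,
    ⟨fun v ↦ Units.map (algebraMap K (v.adicCompletion K)).toMonoidHom a,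
      eventually_mem_units a⟩⟩
  map_one' := Prod.ext (funext fun v ↦ map_one (Units.map (algebraMap K v.Completion).toMonoidHom))
    (RestrictedProduct.ext _ _ fun v ↦
      map_one (Units.map (algebraMap K (v.adicCompletion K)).toMonoidHom))
  map_mul' a b := Prod.ext
    (funext fun v ↦ map_mul (Units.map (algebraMap K v.Completion).toMonoidHom) a b)
    (RestrictedProduct.ext _ _ fun v ↦
      map_mul (Units.map (algebraMap K (v.adicCompletion K)).toMonoidHom) a b)

/-- Principal ideles have norm one (the product formula). -/
theorem diagonal_mem_normOneIdeles (a : Kˣ) : diagonal K a ∈ NormOneIdeles K := by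
  rw [MonoidHom.mem_ker]
  refine Eq.trans ?_ (prod_abs_eq_one a.ne_zero)
  rw [← finprod_comp_equiv (FinitePlace.equivHeightOneSpectrum (K := K)).symm]
  refine congrArg₂ _ (Finset.prod_congr rfl fun v _ ↦ ?_) rfl
  exact congrArg (· ^ v.mult) (InfinitePlace.Completion.norm_coe v _)

variable (K) in
/-- `Kˣ` as a subgroup of `𝕀_K^0`, through the diagonal embedding. -/
def principalIdeles : Subgroup (NormOneIdeles K) :=
  ((diagonal K).codRestrict (NormOneIdeles K) diagonal_mem_normOneIdeles).range

variable (K) in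
/-- The norm-one idele class group `C_K^0 = 𝕀_K^0 / Kˣ`, with the quotient topology. -/
abbrev NormOneIdeleClassGroup : Type _ := NormOneIdeles K ⧸ principalIdeles K

end IdeleClass

end

open scoped nonZeroDivisors

noncomputable section

namespace IdeleClass

variable {K : Type*} [Field K] [NumberField K]

/-! It suffices to find a compact set of norm-one ideles that meets every coset of `Kˣ`. A finite
idele has a fractional ideal. As the class group is finite, finitely many ideles `g` represent all
the classes that occur, and a principal idele gives any `x` the same finite orders as its `g`. Its
finite part then lies in `g · ∏ O_v^*`, which is compact because each `O_v` is. Norm one now fixes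
the product of the infinite absolute values. Units of `𝓞 K` leave finite orders alone, and by
Dirichlet's theorem their logarithms are cocompact in the trace-zero hyperplane, so a unit bounds
every infinite component and its inverse (`exists_boundedIdeles`). -/

/-! ### Local compactness at infinite and finite places -/

instance properSpace_completion (v : InfinitePlace K) : ProperSpace v.Completion where
  isCompact_closedBall x r := by
    have hiso := InfinitePlace.Completion.isometry_extensionEmbedding v
    rw [← hiso.preimage_closedBall]
    exact hiso.isClosedEmbedding.isCompact_preimage (isCompact_closedBall _ _)

/-- The unit topology comes from the closed embedding `y ↦ (y, y⁻¹)`, so both coordinates must be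
bounded. -/
theorem isCompact_units_annulus {F : Type*} [NormedField F] [ProperSpace F] (M : ℝ) :
    IsCompact {y : Fˣ | ‖(y : F)‖ ≤ M ∧ ‖((y⁻¹ : Fˣ) : F)‖ ≤ M} := by
  have hB : IsCompact (Metric.closedBall (0 : F) M) := isCompact_closedBall 0 M
  have h := Units.isClosedEmbedding_embedProduct.isCompact_preimage
    (hB.prod (MulOpposite.opHomeomorph.symm.isCompact_preimage.mpr hB))
  convert h using 1
  ext y
  simp [Units.embedProduct]

theorem isOpen_units_adicCompletionIntegers (v : HeightOneSpectrum (𝓞 K)) :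
    IsOpen ((v.adicCompletionIntegers K).units : Set (v.adicCompletion K)ˣ) :=
  Submonoid.isOpen_units (U := (v.adicCompletionIntegers K).toSubmonoid)
    (Valued.isOpen_valuationSubring (v.adicCompletion K))

theorem valued_algebraMap (v : HeightOneSpectrum (𝓞 K)) (a : K) :
    Valued.v (algebraMap K (v.adicCompletion K) a) = v.valuation K a :=
  v.valuedAdicCompletion_eq_valuation' a

/-- Density of `K` in `K_v`, then approximation of `v`-integral elements of `K` by `𝓞 K`, make the
finite ring `𝓞 K ⧸ v` surject onto the residue field. -/
instance finite_residueField (v : HeightOneSpectrum (𝓞 K)) :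
    Finite (Valued.ResidueField (v.adicCompletion K)) := by
  have : Finite (𝓞 K ⧸ v.asIdeal) := Ideal.finiteQuotientOfFreeOfNeBot _ v.ne_bot
  let f : 𝓞 K →+* Valued.ResidueField (v.adicCompletion K) :=
    (IsLocalRing.residue (Valued.integer (v.adicCompletion K))).comp
      (algebraMap (𝓞 K) (v.adicCompletionIntegers K))
  have hf : ∀ r ∈ v.asIdeal, f r = 0 := by
    intro r hr
    refine (IsLocalRing.residue_eq_zero_iff _).mpr ((Valuation.mem_maximalIdeal_iff _ _).mpr ?_)
    change Valued.v (algebraMap K (v.adicCompletion K) (algebraMap (𝓞 K) K r)) < 1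
    rw [valued_algebraMap]
    exact (v.valuation_lt_one_iff_mem r).mpr hr
  refine Finite.of_surjective (Ideal.Quotient.lift v.asIdeal f hf)
    (Ideal.Quotient.lift_surjective_of_surjective _ hf fun y ↦ ?_)
  obtain ⟨x, rfl⟩ := IsLocalRing.residue_surjective y
  obtain ⟨k, hk⟩ : ∃ k : K, Valued.v ((x : v.adicCompletion K) - algebraMap K _ k) < 1 := by
    have hopen : IsOpen {z : v.adicCompletion K | Valued.v ((x : v.adicCompletion K) - z) < 1} := by
      have h := (Valued.isOpen_ball (v.adicCompletion K) 1).preimage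
        (continuous_const.sub continuous_id : Continuous fun z ↦ (x : v.adicCompletion K) - z)
      simpa [Set.preimage, Valuation.restrict_lt_one_iff] using h
    obtain ⟨k, hk⟩ := (HeightOneSpectrum.denseRange_algebraMap K v).exists_mem_open
      hopen ⟨x, by simp⟩
    exact ⟨k, hk⟩
  have hk1 : v.valuation K k ≤ 1 := by
    rw [← valued_algebraMap]
    have := Valued.v.map_sub (x : v.adicCompletion K) ((x : v.adicCompletion K) - algebraMap K _ k)
    rw [sub_sub_cancel] at this
    exact this.trans (max_le x.2 hk.le)
  obtain ⟨r, hr⟩ := v.exists_valuation_sub_lt_of_integer hk1 1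
  refine ⟨r, ?_⟩
  rw [← sub_eq_zero]
  change IsLocalRing.residue _ _ - _ = 0
  rw [← map_sub]
  refine (IsLocalRing.residue_eq_zero_iff _).mpr ((Valuation.mem_maximalIdeal_iff _ _).mpr ?_)
  change Valued.v (algebraMap K (v.adicCompletion K) (algebraMap (𝓞 K) K r) -
    (x : v.adicCompletion K)) < 1
  have hrk : Valued.v (algebraMap K (v.adicCompletion K) (algebraMap (𝓞 K) K r - k)) < 1 := by
    rwa [valued_algebraMap]
  rw [← sub_sub_sub_cancel_right _ _ (algebraMap K (v.adicCompletion K) k), ← map_sub]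
  exact (Valued.v.map_sub _ _).trans_lt (max_lt hrk hk)

instance compactSpace_adicCompletionIntegers (v : HeightOneSpectrum (𝓞 K)) :
    CompactSpace (v.adicCompletionIntegers K) := by
  have h : CompleteSpace (Valued.integer (v.adicCompletion K)) :=
    (Valued.isClosed_valuationSubring (v.adicCompletion K)).completeSpace_coe
  have h2 : IsDiscreteValuationRing (Valued.integer (v.adicCompletion K)) :=
    inferInstanceAs (IsDiscreteValuationRing (v.adicCompletionIntegers K))
  open Valued.integer in
  exact compactSpace_iff_completeSpace_and_isDiscreteValuationRing_and_finite_residueField.mpr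
    ⟨h, h2, inferInstance⟩

/-! ### Principal ideals and the unit lattice -/

theorem count_spanSingleton (v : HeightOneSpectrum (𝓞 K)) {a : K} (ha : a ≠ 0) :
    FractionalIdeal.count K v (FractionalIdeal.spanSingleton (𝓞 K)⁰ a) =
      -WithZero.log (v.valuation K a) := by
  obtain ⟨n, d, hd, rfl⟩ := IsFractionRing.div_surjective (A := 𝓞 K) a
  have hd0 : d ≠ 0 := nonZeroDivisors.ne_zero hd
  have hn0 : n ≠ 0 := by rintro rfl; simp at ha
  rw [FractionalIdeal.count_well_defined K v (a := d) (J := Ideal.span {n})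
    (FractionalIdeal.spanSingleton_ne_zero_iff.mpr ha)
    (by rw [FractionalIdeal.coeIdeal_span_singleton,
      FractionalIdeal.spanSingleton_mul_spanSingleton, div_eq_inv_mul])]
  rw [map_div₀, HeightOneSpectrum.valuation_of_algebraMap,
    HeightOneSpectrum.valuation_of_algebraMap,
    HeightOneSpectrum.intValuation_if_neg _ hn0, HeightOneSpectrum.intValuation_if_neg _ hd0,
    WithZero.log_div (by simp) (by simp)]
  simp only [WithZero.log_exp]
  ring

open Units in
/-- The unit lattice is cocompact in the hyperplanes of constant coordinate sum. -/
theorem exists_unit_log_bound (C : ℝ) : ∃ R : ℝ, ∀ z : InfinitePlace K → ℝ, ∑ w, z w = C →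
    ∃ ε : (𝓞 K)ˣ, ∀ w : InfinitePlace K, |z w + w.mult * Real.log (w (ε : K))| ≤ R := by
  classical
  let b := (Units.basisUnitLattice K).ofZLatticeBasis ℝ (Units.unitLattice K)
  obtain ⟨r, hr⟩ : ∃ r : ℝ, ∀ z : dirichletUnitTheorem.logSpace K, ‖ZSpan.fract b z‖ ≤ r :=
    ⟨_, ZSpan.norm_fract_le b⟩
  -- `logSpace` omits the place `w₀`. Elsewhere a fractional part is bounded by `r`; the `w₀`
  -- coordinate is `C` minus the others.
  refine ⟨max r (|C| +
    Fintype.card {w : InfinitePlace K // w ≠ dirichletUnitTheorem.w₀} * r), fun z hz ↦ ?_⟩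
  -- The unit sought has minus the lattice part of `z` as its logarithm vector.
  have hmem : -(ZSpan.floor b (fun w ↦ z w.1) : dirichletUnitTheorem.logSpace K) ∈
      unitLattice K := by
    rw [neg_mem_iff,
      ← Module.Basis.ofZLatticeBasis_span ℝ (unitLattice K) (basisUnitLattice K)]
    exact (ZSpan.floor b (fun w ↦ z w.1)).2
  obtain ⟨ε, -, hε⟩ := hmem
  have hle (w : {w : InfinitePlace K // w ≠ dirichletUnitTheorem.w₀}) :
      |z w.1 + w.1.mult * Real.log (w.1 (ε.toMul : K))| ≤ r := by
    refine le_trans (le_of_eq ?_) ((norm_le_pi_norm _ w).trans (hr fun w ↦ z w.1))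
    have := congrFun hε w
    simp only [ZSpan.fract_apply, Pi.sub_apply, Real.norm_eq_abs, sub_eq_add_neg]
    rw [← Pi.neg_apply, ← this]
    rfl
  refine ⟨ε.toMul, fun w ↦ ?_⟩
  by_cases hw : w = dirichletUnitTheorem.w₀
  · refine le_max_of_le_right ?_
    have hsum : ∑ w : InfinitePlace K, (z w + w.mult * Real.log (w (ε.toMul : K))) = C := by
      rw [Finset.sum_add_distrib, hz, Units.sum_mult_mul_log, add_zero]
    rw [Fintype.sum_eq_add_sum_subtype_ne _ w] at hsum
    rw [eq_sub_of_add_eq hsum]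
    subst hw
    refine (abs_sub _ _).trans (add_le_add_right ?_ _)
    refine (Finset.abs_sum_le_sum_abs _ _).trans ((Finset.sum_le_sum fun i _ ↦ hle i).trans ?_)
    simp
  · exact le_max_of_le_left (hle ⟨w, hw⟩)

/-! ### Finite ideles and their fractional ideals -/

variable (K) in
/-- The finite ideles of `K`. -/
abbrev FiniteIdeles : Type _ :=
  Πʳ v : HeightOneSpectrum (𝓞 K), [(v.adicCompletion K)ˣ, (v.adicCompletionIntegers K).units]

instance fact_isOpen_units :
    Fact (∀ v : HeightOneSpectrum (𝓞 K),
      IsOpen ((v.adicCompletionIntegers K).units : Set (v.adicCompletion K)ˣ)) :=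
  ⟨isOpen_units_adicCompletionIntegers⟩

/-- The order of a finite idele at a finite place. -/
def ord (x : FiniteIdeles K) (v : HeightOneSpectrum (𝓞 K)) : ℤ :=
  -WithZero.log (Valued.v (x v : v.adicCompletion K))

theorem ord_eventually_eq_zero (x : FiniteIdeles K) : ∀ᶠ v in Filter.cofinite, ord x v = 0 := by
  filter_upwards [x.eventually] with v hv
  rw [ord, HeightOneSpectrum.adicCompletionIntegers.mem_units_iff_valued_eq_one.mp hv]
  simp

/-- The fractional ideal of a finite idele. -/
def fractionalIdeal (x : FiniteIdeles K) : (FractionalIdeal (𝓞 K)⁰ K)ˣ :=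
  Units.mk0 (∏ᶠ v : HeightOneSpectrum (𝓞 K),
    (v.asIdeal : FractionalIdeal (𝓞 K)⁰ K) ^ ord x v) <|
    finprod_induction (· ≠ 0) one_ne_zero (fun _ _ ↦ mul_ne_zero) fun v ↦
      zpow_ne_zero _ (FractionalIdeal.coeIdeal_ne_zero.mpr v.ne_bot)

theorem count_fractionalIdeal (x : FiniteIdeles K) (v : HeightOneSpectrum (𝓞 K)) :
    FractionalIdeal.count K v (fractionalIdeal x : FractionalIdeal (𝓞 K)⁰ K) = ord x v :=
  FractionalIdeal.count_finprod K v _ (ord_eventually_eq_zero x)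

/-- The two ideals differ by a principal one; its generator is `a`, as comparing multiplicities at
each prime shows. -/
theorem exists_valued_eq_of_mk_eq {x y : FiniteIdeles K}
    (h : ClassGroup.mk K (fractionalIdeal x) = ClassGroup.mk K (fractionalIdeal y)) :
    ∃ a : Kˣ, ∀ v : HeightOneSpectrum (𝓞 K),
      Valued.v (x v : v.adicCompletion K) =
        Valued.v (algebraMap K (v.adicCompletion K) a) * Valued.v (y v : v.adicCompletion K) := by
  rw [← div_eq_one, ← map_div, ClassGroup.mk_eq_one_iff, FractionalIdeal.isPrincipal_iff] at h
  obtain ⟨a, ha⟩ := h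
  have ha0 : a ≠ 0 := by
    rintro rfl
    exact (fractionalIdeal x / fractionalIdeal y).ne_zero (by rw [ha, FractionalIdeal.spanSingleton_zero])
  refine ⟨Units.mk0 a ha0, fun v ↦ ?_⟩
  have hxy : (fractionalIdeal x : FractionalIdeal (𝓞 K)⁰ K) =
      FractionalIdeal.spanSingleton (𝓞 K)⁰ a * fractionalIdeal y := by
    rw [← ha, ← Units.val_mul, div_mul_cancel]
  have hc := congrArg (FractionalIdeal.count K v) hxy
  rw [FractionalIdeal.count_mul K v (FractionalIdeal.spanSingleton_ne_zero_iff.mpr ha0)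
    (fractionalIdeal y).ne_zero, count_fractionalIdeal, count_fractionalIdeal,
    count_spanSingleton v ha0, ord, ord] at hc
  rw [Units.val_mk0, valued_algebraMap]
  have hx0 : Valued.v (x v : v.adicCompletion K) ≠ 0 := by simp
  have hy0 : Valued.v (y v : v.adicCompletion K) ≠ 0 := by simp
  have hv0 : v.valuation K a ≠ 0 := by simpa using ha0
  rw [← WithZero.exp_log hx0, ← WithZero.exp_log hy0, ← WithZero.exp_log hv0, ← WithZero.exp_add]
  congr 1
  linarith

/-- This is the translate by `g` of `∏ O_v^*`, compact by Tychonoff. -/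
theorem isCompact_setOf_valued_eq (g : FiniteIdeles K) :
    IsCompact {x : FiniteIdeles K | ∀ v : HeightOneSpectrum (𝓞 K),
      Valued.v (x v : v.adicCompletion K) = Valued.v (g v : v.adicCompletion K)} := by
  have hc (v : HeightOneSpectrum (𝓞 K)) :
      CompactSpace ((v.adicCompletionIntegers K).units : Set (v.adicCompletion K)ˣ) :=
    isCompact_iff_compactSpace.mp <|
      Submonoid.units_isCompact (S := (v.adicCompletionIntegers K).toSubmonoid)
        (isCompact_iff_compactSpace.mpr (compactSpace_adicCompletionIntegers v))
  have hr := isCompact_range (RestrictedProduct.isEmbedding_structureMap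
    (R := fun v : HeightOneSpectrum (𝓞 K) ↦ (v.adicCompletion K)ˣ)
    (A := fun v ↦ ((v.adicCompletionIntegers K).units : Set (v.adicCompletion K)ˣ))
    (𝓕 := Filter.cofinite)).continuous
  convert hr.image (continuous_const_mul g) using 1
  ext x
  simp only [Set.mem_ofPred_eq, Set.mem_image, Set.exists_range_iff]
  constructor
  · intro h
    refine ⟨fun v ↦ ⟨(g v)⁻¹ * x v, ?_⟩, ?_⟩
    · refine HeightOneSpectrum.adicCompletionIntegers.mem_units_iff_valued_eq_one.mpr ?_
      simp [h v]
    · ext v : 1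
      exact mul_inv_cancel_left _ _
  · rintro ⟨u, rfl⟩ v
    have := HeightOneSpectrum.adicCompletionIntegers.mem_units_iff_valued_eq_one.mp (u v).2
    change Valued.v ((g v * (u v).1 : (v.adicCompletion K)ˣ) : v.adicCompletion K) = _
    simp [this]

/-! ### A compact set meeting every coset -/

theorem exists_unit_norm_bound (N : ℝ) : ∃ M : ℝ,
    ∀ y : (v : InfinitePlace K) → (v.Completion)ˣ,
      ∏ v, ‖(y v : v.Completion)‖ ^ v.mult = N →
      ∃ ε : (𝓞 K)ˣ, ∀ v : InfinitePlace K,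
        ‖(y v : v.Completion)‖ * v (ε : K) ≤ M ∧ (‖(y v : v.Completion)‖ * v (ε : K))⁻¹ ≤ M := by
  obtain ⟨R, hR⟩ := exists_unit_log_bound (K := K) (Real.log N)
  refine ⟨Real.exp R, fun y hy ↦ ?_⟩
  obtain ⟨ε, hε⟩ := hR (fun v ↦ v.mult * Real.log ‖(y v : v.Completion)‖) (by
    rw [← hy, Real.log_prod fun v _ ↦ by simp]
    simp)
  refine ⟨ε, fun v ↦ ?_⟩
  have hy0 : 0 < ‖(y v : v.Completion)‖ := by simp
  have hε0 : 0 < v (ε : K) := InfinitePlace.pos_iff.mpr (Units.coe_ne_zero ε)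
  have hpos := mul_pos hy0 hε0
  have h := hε v
  rw [← mul_add, ← Real.log_mul hy0.ne' hε0.ne', abs_mul, Nat.abs_cast] at h
  -- Since `v.mult ≥ 1`, the factor can be dropped.
  have hlog : |Real.log (‖(y v : v.Completion)‖ * v (ε : K))| ≤ R :=
    (le_mul_of_one_le_left (abs_nonneg _) (by exact_mod_cast v.mult_pos)).trans h
  rw [abs_le] at hlog
  rw [← Real.log_le_iff_le_exp hpos, ← Real.log_le_iff_le_exp (inv_pos.mpr hpos), Real.log_inv]
  exact ⟨hlog.2, by linarith⟩

/-- The finite part of the idele norm. -/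
def finiteNorm (x : FiniteIdeles K) : ℝ :=
  ∏ᶠ v : HeightOneSpectrum (𝓞 K), ‖(x v : v.adicCompletion K)‖

theorem finiteNorm_congr {x y : FiniteIdeles K} (h : ∀ v : HeightOneSpectrum (𝓞 K),
    Valued.v (x v : v.adicCompletion K) = Valued.v (y v : v.adicCompletion K)) :
    finiteNorm x = finiteNorm y :=
  finprod_congr fun v ↦ by rw [FinitePlace.norm_def, FinitePlace.norm_def, h v]

/-- The ideles of norm one whose finite part has the same orders as `g`, and whose
infinite components and their inverses are bounded by `M`. -/
def boundedIdeles (g : FiniteIdeles K) (M : ℝ) : Set (Ideles K) :=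
  {y | (∀ v, ‖(y v : v.Completion)‖ ≤ M ∧ ‖(((y v)⁻¹ : (v.Completion)ˣ) : v.Completion)‖ ≤ M) ∧
    (∏ v, ‖(y v : v.Completion)‖ ^ v.mult) * finiteNorm g = 1} ×ˢ
  {x | ∀ v : HeightOneSpectrum (𝓞 K),
    Valued.v (x v : v.adicCompletion K) = Valued.v (g v : v.adicCompletion K)}

theorem isCompact_boundedIdeles (g : FiniteIdeles K) (M : ℝ) : IsCompact (boundedIdeles g M) := by
  refine IsCompact.prod ?_ (isCompact_setOf_valued_eq g)
  have h := isCompact_univ_pi fun v : InfinitePlace K ↦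
    isCompact_units_annulus (F := v.Completion) M
  have hcl : IsClosed {y : (v : InfinitePlace K) → (v.Completion)ˣ |
      (∏ v, ‖(y v : v.Completion)‖ ^ v.mult) * finiteNorm g = 1} := by
    refine isClosed_eq (.mul (continuous_finsetProd _ fun v _ ↦ ?_) continuous_const)
      continuous_const
    exact ((Units.continuous_val.comp (continuous_apply v)).norm).pow _
  convert h.inter_right hcl using 1
  ext y
  simp [Set.mem_pi]

theorem boundedIdeles_subset (g : FiniteIdeles K) (M : ℝ) :
    boundedIdeles g M ⊆ NormOneIdeles K := by
  rintro x ⟨⟨-, h₁⟩, h₂⟩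
  rw [← finiteNorm_congr h₂] at h₁
  exact h₁

theorem exists_boundedIdeles (g : FiniteIdeles K) : ∃ M : ℝ, ∀ x ∈ NormOneIdeles K,
    ClassGroup.mk K (fractionalIdeal x.2) = ClassGroup.mk K (fractionalIdeal g) →
    ∃ a : Kˣ, x * diagonal K a ∈ boundedIdeles g M := by
  obtain ⟨M, hM⟩ := exists_unit_norm_bound (K := K) (finiteNorm g)⁻¹
  refine ⟨M, fun x hx hxg ↦ ?_⟩
  obtain ⟨a, ha⟩ := exists_valued_eq_of_mk_eq hxg
  have hfin (x' : Ideles K) (hx' : x' ∈ NormOneIdeles K) (h : ∀ v : HeightOneSpectrum (𝓞 K),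
      Valued.v (x'.2 v : v.adicCompletion K) = Valued.v (g v : v.adicCompletion K)) :
      (∏ v, ‖(x'.1 v : v.Completion)‖ ^ v.mult) * finiteNorm g = 1 := by
    rw [← finiteNorm_congr h]
    exact hx'
  have hmul (b : Kˣ) : x * diagonal K b ∈ NormOneIdeles K :=
    mul_mem hx (diagonal_mem_normOneIdeles b)
  have hval (b : Kˣ) (v : HeightOneSpectrum (𝓞 K)) :
      Valued.v ((x * diagonal K b).2 v : v.adicCompletion K) =
        Valued.v (x.2 v : v.adicCompletion K) * v.valuation K (b : K) := by
    rw [← valued_algebraMap, ← map_mul]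
    rfl
  have hnorm (b : Kˣ) (v : InfinitePlace K) :
      ‖((x * diagonal K b).1 v : v.Completion)‖ = ‖(x.1 v : v.Completion)‖ * v (b : K) := by
    refine (norm_mul (x.1 v : v.Completion) (algebraMap K v.Completion b)).trans ?_
    exact congrArg _ (InfinitePlace.Completion.norm_coe v _)
  have hva (v : HeightOneSpectrum (𝓞 K)) :
      Valued.v ((x * diagonal K a⁻¹).2 v : v.adicCompletion K) =
        Valued.v (g v : v.adicCompletion K) := by
    rw [hval, ha, valued_algebraMap, mul_right_comm, ← map_mul]
    simp
  -- Once the finite orders agree with `g`, the infinite product is `(finiteNorm g)⁻¹`, so `M`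
  -- depends on `g` alone.
  obtain ⟨ε, hε⟩ := hM (x * diagonal K a⁻¹).1 (eq_inv_of_mul_eq_one_left (hfin _ (hmul _) hva))
  have hvε (v : HeightOneSpectrum (𝓞 K)) : v.valuation K (ε : K) = 1 :=
    (v.valuation_of_algebraMap _).trans (HeightOneSpectrum.intValuation_eq_one_iff.mpr
      fun h ↦ v.isPrime.ne_top (Ideal.eq_top_of_isUnit_mem _ h ε.isUnit))
  have hv (v : HeightOneSpectrum (𝓞 K)) :
      Valued.v ((x * diagonal K (a⁻¹ * Units.map (algebraMap (𝓞 K) K).toMonoidHom ε)).2 v :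
        v.adicCompletion K) = Valued.v (g v : v.adicCompletion K) := by
    rw [← hva, hval, hval, Units.val_mul, map_mul]
    exact congrArg _ ((congrArg _ (hvε v)).trans (mul_one _))
  refine ⟨_, ⟨fun v ↦ ?_, hfin _ (hmul _) hv⟩, hv⟩
  have := hε v
  rw [hnorm, mul_assoc, ← map_mul] at this
  rw [Units.val_inv_eq_inv_val, norm_inv, hnorm]
  exact this

theorem exists_isCompact_mul_diagonal_mem : ∃ T : Set (Ideles K), IsCompact T ∧
    T ⊆ NormOneIdeles K ∧ ∀ x ∈ NormOneIdeles K, ∃ a : Kˣ, x * diagonal K a ∈ T := by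
  let cls : FiniteIdeles K → ClassGroup (𝓞 K) := fun x ↦ ClassGroup.mk K (fractionalIdeal x)
  choose M hM using exists_boundedIdeles (K := K)
  -- Only classes in the range need representatives, so surjectivity of `cls` plays no role.
  choose g hg using fun c : Set.range cls ↦ c.2
  refine ⟨⋃ c, boundedIdeles (g c) (M (g c)), isCompact_iUnion fun c ↦ isCompact_boundedIdeles _ _,
    Set.iUnion_subset fun c ↦ boundedIdeles_subset _ _, fun x hx ↦ ?_⟩
  obtain ⟨a, ha⟩ := hM (g ⟨cls x.2, x.2, rfl⟩) x hx (hg ⟨cls x.2, x.2, rfl⟩).symm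
  exact ⟨a, Set.mem_iUnion_of_mem _ ha⟩

theorem compactSpace_normOneIdeleClassGroup : CompactSpace (NormOneIdeleClassGroup K) := by
  obtain ⟨T, hT, hsub, hmem⟩ := exists_isCompact_mul_diagonal_mem (K := K)
  -- Compactness passes to the subspace because `T` lies inside it.
  have hT' : IsCompact (Subtype.val ⁻¹' T : Set (NormOneIdeles K)) :=
    (Topology.IsInducing.subtypeVal.isCompact_preimage_iff (by rwa [Subtype.range_coe])).mpr hT
  have hsurj (q : NormOneIdeleClassGroup K) :
      q ∈ QuotientGroup.mk (s := principalIdeles K) '' (Subtype.val ⁻¹' T) := by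
    obtain ⟨x, rfl⟩ := QuotientGroup.mk_surjective q
    obtain ⟨a, ha⟩ := hmem x.1 x.2
    let d : NormOneIdeles K := ⟨diagonal K a, diagonal_mem_normOneIdeles a⟩
    have hd : d ∈ principalIdeles K := ⟨a, rfl⟩
    have hxd : (x * d).1 ∈ T := ha
    exact ⟨x * d, hxd, QuotientGroup.mk_mul_of_mem x hd⟩
  refine ⟨?_⟩
  rw [← Set.eq_univ_of_forall hsurj]
  exact hT'.image continuous_quotient_mk'

end IdeleClass

end

theorem mainTheorem1 (k : Type*) [Field k] [NumberField k] :
    CompactSpace (IdeleClass.NormOneIdeleClassGroup k) :=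
  IdeleClass.compactSpace_normOneIdeleClassGroup
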